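/- Let $\mathbb{K}$ be a field and let $R=\mathbb{K}[x_1,\dots,x_n]$ with its standard grading by total degree. For a homogeneous ideal $A\subseteq R$ let $\mathrm{pd}(R/A)$ be the projective dimension of the $R$-module $R/A$ (equal to $-\infty$ when $A=R$), let $\beta_{i,j}(R/A)=\dim_{\mathbb{K}}\mathrm{Tor}^R_i(R/A,\mathbb{K})_j$ be its graded Betti numbers, where $\mathbb{K}=R/(x_1,\dots,x_n)$, and let $\mathrm{reg}(R/A)=\sup\{\,j-i : \beta_{i,j}(R/A)\neq 0\,\}$ be its Castelnuovo–Mumford regularity. **Lemma.** Let $I$, $J$, $K$ be monomial ideals of $R$ with $I=J+K$, and let $q,r\ge 0$ be integers such that $$\mathrm{pd}(R/J)<q,\qquad \mathrm{pd}(R/K)=q,\qquad \mathrm{reg}(R/K)<r .$$ If $\mathrm{pd}(R/(J\cap K))=q$ and $\beta_{q,q+r}(R/(J\cap K))\neq 0$, then $\mathrm{pd}(R/I)=q+1$. -/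

import Mathlib

open MvPolynomial TensorProduct

universe u

noncomputable section

namespace MonomialSplitting

/-- The polynomial ring `R = 𝕜[x₁, …, xₙ]`, graded by total degree. -/
abbrev Poly (𝕜 : Type u) [Field 𝕜] (n : ℕ) : Type u := MvPolynomial (Fin n) 𝕜

/-- A monomial ideal: an ideal generated by monomials. -/
def IsMonomialIdeal {𝕜 : Type u} [Field 𝕜] {n : ℕ} (I : Ideal (Poly 𝕜 n)) : Prop :=
  ∃ S : Set (Fin n →₀ ℕ), I = Ideal.span ((fun m => monomial m (1 : 𝕜)) '' S)

/-- The degree `d` piece of `R/I`: the image of the homogeneous polynomials of degree `d`. -/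
def quotGrading {𝕜 : Type u} [Field 𝕜] {n : ℕ} (I : Ideal (Poly 𝕜 n)) (d : ℕ) :
    Submodule 𝕜 (Poly 𝕜 n ⧸ I) :=
  (homogeneousSubmodule (Fin n) 𝕜 d).map (Ideal.Quotient.mkₐ 𝕜 I).toLinearMap

/-- The degree `e` piece of the graded free module `⨁ₐ R(-deg a)`, whose basis vector indexed
by `a` sits in degree `deg a`. -/
def freeGrading {𝕜 : Type u} [Field 𝕜] {n : ℕ} {ι : Type u} (deg : ι → ℕ) (e : ℕ) :
    Submodule 𝕜 (ι →₀ Poly 𝕜 n) where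
  carrier := {x | ∀ a m, coeff m (x a) ≠ 0 → m.degree + deg a = e}
  zero_mem' := by simp
  add_mem' := by
    intro x y hx hy a m h
    by_cases h1 : coeff m (x a) = 0
    · refine hy a m ?_
      simpa [h1] using h
    · exact hx a m h1
  smul_mem' := by
    intro c x hx a m h
    refine hx a m ?_
    intro h0
    simp [h0] at h

/-- A graded free resolution `⋯ → F₂ → F₁ → F₀ → 𝕜 → 0` of the graded `R`-module
`𝕜 = R/(x₁, …, xₙ)`: `F p` is free on `ι p`, the basis vector `a` having degree `deg p a`, and
all maps are homogeneous of degree `0`. -/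
structure GradedFreeResolution (𝕜 : Type u) [Field 𝕜] (n : ℕ) where
  ι : ℕ → Type u
  deg : ∀ p, ι p → ℕ
  d : ∀ p, (ι (p + 1) →₀ Poly 𝕜 n) →ₗ[Poly 𝕜 n] (ι p →₀ Poly 𝕜 n)
  ε : (ι 0 →₀ Poly 𝕜 n) →ₗ[Poly 𝕜 n] (Poly 𝕜 n ⧸ idealOfVars (Fin n) 𝕜)
  d_homogeneous : ∀ p a, d p (Finsupp.single a 1) ∈ freeGrading (deg p) (deg (p + 1) a)
  ε_homogeneous : ∀ a, ε (Finsupp.single a 1) ∈ quotGrading (idealOfVars (Fin n) 𝕜) (deg 0 a)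
  ε_surjective : Function.Surjective ε
  exact_zero : Function.Exact (d 0) ε
  exact_succ : ∀ p, Function.Exact (d (p + 1)) (d p)

/-! Existence of a graded free resolution of `𝕜`. -/

/-- Projection of `⨁ₐ R(-deg a)` onto its degree `e` piece. -/
def freeComponent {𝕜 : Type u} [Field 𝕜] {n : ℕ} {ι : Type u} (deg : ι → ℕ) (e : ℕ) :
    (ι →₀ Poly 𝕜 n) →ₗ[𝕜] (ι →₀ Poly 𝕜 n) :=
  Finsupp.lsum 𝕜 fun a => (Finsupp.lsingle a).comp
    (if deg a ≤ e then homogeneousComponent (e - deg a) else 0)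

theorem coeff_freeComponent {𝕜 : Type u} [Field 𝕜] {n : ℕ} {ι : Type u} (deg : ι → ℕ) (e : ℕ)
    (x : ι →₀ Poly 𝕜 n) (a : ι) (m : Fin n →₀ ℕ) :
    coeff m (freeComponent deg e x a) = if m.degree + deg a = e then coeff m (x a) else 0 := by
  classical
  induction x using Finsupp.induction_linear with
  | zero => simp
  | add f g hf hg =>
    rw [map_add, Finsupp.add_apply, coeff_add, hf, hg, Finsupp.add_apply, coeff_add]
    split_ifs <;> simp
  | single b r =>
    simp only [freeComponent, Finsupp.lsum_single, LinearMap.comp_apply, Finsupp.lsingle_apply,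
      Finsupp.single_apply]
    by_cases hb : b = a
    · subst hb
      by_cases hd : deg b ≤ e
      · simp only [if_true, if_pos hd, coeff_homogeneousComponent]
        congr 1
        apply propext
        omega
      · have : ¬ (m.degree + deg b = e) := by omega
        simp [hd, this]
    · simp [hb]

theorem freeComponent_mem {𝕜 : Type u} [Field 𝕜] {n : ℕ} {ι : Type u} (deg : ι → ℕ) (e : ℕ)
    (x : ι →₀ Poly 𝕜 n) : freeComponent deg e x ∈ freeGrading deg e := by
  intro a m h
  rw [coeff_freeComponent] at h
  by_contra h'
  simp [h'] at h

theorem freeComponent_of_mem {𝕜 : Type u} [Field 𝕜] {n : ℕ} {ι : Type u} (deg : ι → ℕ) (e e' : ℕ)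
    (x : ι →₀ Poly 𝕜 n) (hx : x ∈ freeGrading deg e') :
    freeComponent deg e x = if e' = e then x else 0 := by
  ext a m
  rw [coeff_freeComponent]
  by_cases h0 : coeff m (x a) = 0
  · split_ifs <;> simp [h0]
  · have h := hx a m h0
    rw [h]
    split_ifs <;> simp

theorem smul_mem_freeGrading {𝕜 : Type u} [Field 𝕜] {n : ℕ} {ι : Type u} (deg : ι → ℕ) (e : ℕ)
    (x : ι →₀ Poly 𝕜 n) (hx : x ∈ freeGrading deg e) (m : Fin n →₀ ℕ) (c : 𝕜) :
    (monomial m c : Poly 𝕜 n) • x ∈ freeGrading deg (m.degree + e) := by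
  classical
  intro a k h
  rw [Finsupp.smul_apply, smul_eq_mul, coeff_monomial_mul'] at h
  split_ifs at h with hk
  · have := hx a (k - m) (right_ne_zero_of_mul h)
    obtain ⟨l, rfl⟩ := exists_add_of_le hk
    rw [add_tsub_cancel_left] at this
    rw [map_add, ← this, add_assoc]
  · exact absurd rfl h

theorem freeComponent_comm {𝕜 : Type u} [Field 𝕜] {n : ℕ} {ι ι' : Type u} (deg : ι → ℕ)
    (deg' : ι' → ℕ) (L : (ι' →₀ Poly 𝕜 n) →ₗ[Poly 𝕜 n] (ι →₀ Poly 𝕜 n))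
    (hL : ∀ a, L (Finsupp.single a 1) ∈ freeGrading deg (deg' a)) (e : ℕ) (f : ι' →₀ Poly 𝕜 n) :
    freeComponent deg e (L f) = L (freeComponent deg' e f) := by
  induction f using Finsupp.induction_linear with
  | zero => simp
  | add f g hf hg => simp only [map_add, hf, hg]
  | single a r =>
    induction r using MvPolynomial.induction_on' with
    | add p q hp hq => simp only [Finsupp.single_add, map_add, hp, hq]
    | monomial m c =>
      have h1 : (Finsupp.single a (monomial m c) : ι' →₀ Poly 𝕜 n)
          = (monomial m c : Poly 𝕜 n) • Finsupp.single a 1 := by simp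
      have h2 : (Finsupp.single a 1 : ι' →₀ Poly 𝕜 n) ∈ freeGrading deg' (deg' a) := by
        classical
        intro b k h
        rw [Finsupp.single_apply] at h
        split_ifs at h with hb
        · subst hb
          rw [coeff_one] at h
          split_ifs at h with hk
          · subst hk; simp
          · exact absurd rfl h
        · simp at h
      rw [h1, map_smul, freeComponent_of_mem _ _ _ _ (smul_mem_freeGrading _ _ _ (hL a) m c),
        freeComponent_of_mem _ _ _ _ (smul_mem_freeGrading _ _ _ h2 m c)]
      split_ifs
      · rw [map_smul]
      · rw [map_zero]

theorem exists_sum_freeComponent {𝕜 : Type u} [Field 𝕜] {n : ℕ} {ι : Type u} (deg : ι → ℕ)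
    (f : ι →₀ Poly 𝕜 n) :
    ∃ B, ∀ B' ≥ B, ∑ e ∈ Finset.range B', freeComponent deg e f = f := by
  induction f using Finsupp.induction_linear with
  | zero => exact ⟨0, by simp⟩
  | add f g hf hg =>
    obtain ⟨B, hB⟩ := hf
    obtain ⟨C, hC⟩ := hg
    refine ⟨max B C, fun B' h => ?_⟩
    simp only [map_add, Finset.sum_add_distrib]
    rw [hB B' (le_trans (le_max_left _ _) h), hC B' (le_trans (le_max_right _ _) h)]
  | single a r =>
    refine ⟨deg a + r.totalDegree + 1, fun B' h => ?_⟩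
    ext b m
    rw [Finsupp.finsetSum_apply, coeff_sum]
    simp only [coeff_freeComponent]
    rw [Finset.sum_ite_eq]
    split_ifs with hm
    · rfl
    · classical
      rw [Finsupp.single_apply]
      split_ifs with hb
      · subst hb
        symm
        by_contra h0
        have := le_totalDegree (mem_support_iff.2 h0)
        rw [Finset.mem_range] at hm
        have h3 : m.degree ≤ r.totalDegree := by
          rw [Finsupp.degree_apply]
          exact this
        omega
      · simp

/-- One stage of the resolution: a graded free module with a graded submodule. -/
structure Stage (𝕜 : Type u) [Field 𝕜] (n : ℕ) where
  ι : Type u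
  deg : ι → ℕ
  N : Submodule (Poly 𝕜 n) (ι →₀ Poly 𝕜 n)
  hN : ∀ x ∈ N, ∀ e, freeComponent deg e x ∈ N

/-- The map onto `N` from the free module on the homogeneous elements of `N`. -/
def Stage.map {𝕜 : Type u} [Field 𝕜] {n : ℕ} (s : Stage 𝕜 n) :
    ((Σ e : ℕ, {x // x ∈ s.N ∧ x ∈ freeGrading s.deg e}) →₀ Poly 𝕜 n) →ₗ[Poly 𝕜 n]
      (s.ι →₀ Poly 𝕜 n) :=
  Finsupp.linearCombination (Poly 𝕜 n) fun y => y.2.1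

theorem Stage.map_homogeneous {𝕜 : Type u} [Field 𝕜] {n : ℕ} (s : Stage 𝕜 n)
    (a : Σ e : ℕ, {x // x ∈ s.N ∧ x ∈ freeGrading s.deg e}) :
    s.map (Finsupp.single a 1) ∈ freeGrading s.deg a.1 := by
  simpa [Stage.map] using a.2.2.2

theorem Stage.range_map {𝕜 : Type u} [Field 𝕜] {n : ℕ} (s : Stage 𝕜 n) :
    LinearMap.range s.map = s.N := by
  apply le_antisymm
  · rw [Stage.map, Finsupp.range_linearCombination, Submodule.span_le]
    rintro _ ⟨y, rfl⟩
    exact y.2.2.1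
  · intro x hx
    obtain ⟨B, hB⟩ := exists_sum_freeComponent s.deg x
    rw [← hB B le_rfl]
    refine Submodule.sum_mem _ fun e _ => ?_
    refine ⟨Finsupp.single ⟨e, freeComponent s.deg e x, s.hN x hx e, freeComponent_mem _ _ _⟩ 1, ?_⟩
    simp [Stage.map]

/-- The next stage: the kernel of `s.map`. -/
def Stage.next {𝕜 : Type u} [Field 𝕜] {n : ℕ} (s : Stage 𝕜 n) : Stage 𝕜 n where
  ι := Σ e : ℕ, {x // x ∈ s.N ∧ x ∈ freeGrading s.deg e}
  deg := Sigma.fst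
  N := LinearMap.ker s.map
  hN := by
    intro x hx e
    rw [LinearMap.mem_ker] at hx ⊢
    rw [← freeComponent_comm s.deg Sigma.fst s.map s.map_homogeneous, hx, map_zero]

theorem mem_vars {𝕜 : Type u} [Field 𝕜] {n : ℕ} (f : Poly 𝕜 n) :
    f ∈ idealOfVars (Fin n) 𝕜 ↔ coeff 0 f = 0 := by
  rw [idealOfVars, ← Set.image_univ, mem_ideal_span_X_image]
  constructor
  · intro h
    by_contra h0
    obtain ⟨i, _, hi⟩ := h 0 (mem_support_iff.2 h0)
    simp at hi
  · intro h m hm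
    by_contra! h'
    have : m = 0 := by
      ext i
      simpa using h' i (Set.mem_univ i)
    subst this
    exact mem_support_iff.1 hm h

/-- The map `R → R/(x₁, …, xₙ)`. -/
def augmentation (𝕜 : Type u) [Field 𝕜] (n : ℕ) :
    (PUnit.{u + 1} →₀ Poly 𝕜 n) →ₗ[Poly 𝕜 n] (Poly 𝕜 n ⧸ idealOfVars (Fin n) 𝕜) :=
  (Submodule.mkQ (idealOfVars (Fin n) 𝕜)).comp (Finsupp.lapply PUnit.unit)

/-- The initial stage: `(x₁, …, xₙ) ⊆ R`. -/
def Stage.init (𝕜 : Type u) [Field 𝕜] (n : ℕ) : Stage 𝕜 n where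
  ι := PUnit.{u + 1}
  deg := fun _ => 0
  N := LinearMap.ker (augmentation 𝕜 n)
  hN := by
    intro x hx e
    rw [LinearMap.mem_ker, augmentation, LinearMap.comp_apply, Submodule.mkQ_apply,
      Submodule.Quotient.mk_eq_zero, Finsupp.lapply_apply, mem_vars] at hx ⊢
    rw [coeff_freeComponent, hx]
    simp

theorem augmentation_single {𝕜 : Type u} [Field 𝕜] {n : ℕ} (r : Poly 𝕜 n) :
    augmentation 𝕜 n (Finsupp.single PUnit.unit r) = Ideal.Quotient.mk _ r := by
  rw [augmentation, LinearMap.comp_apply, Finsupp.lapply_apply, Finsupp.single_eq_same]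
  rfl

theorem Stage.exact_next {𝕜 : Type u} [Field 𝕜] {n : ℕ} (s : Stage 𝕜 n) :
    Function.Exact s.next.map s.map :=
  LinearMap.exact_iff.2 (Stage.range_map s.next).symm

theorem Stage.exact_init (𝕜 : Type u) [Field 𝕜] (n : ℕ) :
    Function.Exact (Stage.init 𝕜 n).map (augmentation 𝕜 n) :=
  LinearMap.exact_iff.2 (Stage.range_map (Stage.init 𝕜 n)).symm

instance (𝕜 : Type u) [Field 𝕜] (n : ℕ) : Nonempty (GradedFreeResolution 𝕜 n) := by
  let s : ℕ → Stage 𝕜 n := fun p => Nat.rec (Stage.init 𝕜 n) (fun _ t => t.next) p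
  refine ⟨{
    ι := fun p => (s p).ι
    deg := fun p => (s p).deg
    d := fun p => (s p).map
    ε := augmentation 𝕜 n
    d_homogeneous := fun p a => (s p).map_homogeneous a
    ε_homogeneous := fun a => ⟨1, isHomogeneous_one _ _, ?_⟩
    ε_surjective := ?_
    exact_zero := ?_
    exact_succ := fun p => ?_ }⟩
  · exact (augmentation_single 1).symm
  · intro y
    obtain ⟨r, rfl⟩ := Ideal.Quotient.mk_surjective y
    exact ⟨Finsupp.single PUnit.unit r, augmentation_single r⟩
  · exact Stage.exact_init 𝕜 n
  · exact Stage.exact_next (s p)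

/-- A graded free resolution of `𝕜`. -/
def residueResolution (𝕜 : Type u) [Field 𝕜] (n : ℕ) : GradedFreeResolution 𝕜 n :=
  Classical.choice inferInstance

/-! Graded `Tor`, Betti numbers and regularity of a graded module `M` with graded pieces
`𝓜 0, 𝓜 1, …`. -/

section Tor

variable {𝕜 : Type u} [Field 𝕜] {n : ℕ} (M : Type u) [AddCommGroup M] [Module (Poly 𝕜 n) M]

/-- The `p`-th term of the complex `M ⊗ F`, where `F` is the graded free resolution of `𝕜`. -/
abbrev TorChain (p : ℕ) : Type u :=
  M ⊗[Poly 𝕜 n] ((residueResolution 𝕜 n).ι p →₀ Poly 𝕜 n)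

/-- The differential of `M ⊗ F`. -/
def torD (p : ℕ) : TorChain (𝕜 := 𝕜) (n := n) M (p + 1) →ₗ[Poly 𝕜 n] TorChain (𝕜 := 𝕜) (n := n) M p :=
  LinearMap.lTensor M ((residueResolution 𝕜 n).d p)

/-- The cycles of `M ⊗ F`; in homological degree `0` every chain is a cycle. -/
def torCycles : ∀ p : ℕ, Submodule (Poly 𝕜 n) (TorChain (𝕜 := 𝕜) (n := n) M p)
  | 0 => ⊤
  | p + 1 => LinearMap.ker (torD M p)

/-- `Tor_p^R(M, 𝕜)`, the `p`-th homology of `M ⊗ F`. -/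
abbrev GradedTor (p : ℕ) : Type u :=
  ↥(torCycles (𝕜 := 𝕜) (n := n) M p) ⧸
    (LinearMap.range (torD (𝕜 := 𝕜) (n := n) M p)).submoduleOf (torCycles M p)

variable {M} [Module 𝕜 M] [IsScalarTower 𝕜 (Poly 𝕜 n) M] (𝓜 : ℕ → Submodule 𝕜 M)

/-- The degree `j` piece of `M ⊗ F_p`: it is spanned by the `m ⊗ a` with `m` homogeneous, `a` a
basis vector of `F_p` and `deg m + deg a = j`. -/
def torChainGrading (p j : ℕ) : Submodule 𝕜 (TorChain (𝕜 := 𝕜) (n := n) M p) :=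
  Submodule.span 𝕜 {t | ∃ (s : ℕ) (m : M) (a : (residueResolution 𝕜 n).ι p),
    m ∈ 𝓜 s ∧ s + (residueResolution 𝕜 n).deg p a = j ∧ t = m ⊗ₜ Finsupp.single a 1}

/-- The degree `j` piece `Tor_p^R(M, 𝕜)_j`: the classes of the cycles of degree `j`. -/
def torGrading (p j : ℕ) : Submodule 𝕜 (GradedTor (𝕜 := 𝕜) (n := n) M p) :=
  ((torChainGrading 𝓜 p j).comap ((torCycles M p).subtype.restrictScalars 𝕜)).map
    ((Submodule.mkQ ((LinearMap.range (torD (𝕜 := 𝕜) (n := n) M p)).submoduleOf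
      (torCycles M p))).restrictScalars 𝕜)

/-- The graded Betti number `β_{i,j}(M) = dim_𝕜 Tor_i^R(M, 𝕜)_j`. -/
def gradedBetti (i j : ℕ) : ℕ∞ :=
  Cardinal.toENat (Module.rank 𝕜 (torGrading (n := n) 𝓜 i j))

/-- The Castelnuovo–Mumford regularity `reg M = sup {j - i : β_{i,j}(M) ≠ 0}`, which is `-∞`
when there is no nonzero Betti number. -/
def regularity : WithBot (WithTop ℤ) :=
  sSup {t | ∃ i j : ℕ, gradedBetti (n := n) 𝓜 i j ≠ 0 ∧
    t = (((j : ℤ) - (i : ℤ) : ℤ) : WithBot (WithTop ℤ))}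

end Tor

section Quotient

variable {𝕜 : Type u} [Field 𝕜] {n : ℕ}

/-- `pd_R(R/I)`; it is `⊥` when `R/I = 0`. -/
def pdQuot (I : Ideal (Poly 𝕜 n)) : WithBot ℕ∞ :=
  CategoryTheory.projectiveDimension (ModuleCat.of (Poly 𝕜 n) (Poly 𝕜 n ⧸ I))

/-- `β_{i,j}(R/I)`. -/
def bettiQuot (I : Ideal (Poly 𝕜 n)) (i j : ℕ) : ℕ∞ :=
  gradedBetti (n := n) (quotGrading I) i j

/-- `reg(R/I)`. -/
def regQuot (I : Ideal (Poly 𝕜 n)) : WithBot (WithTop ℤ) :=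
  regularity (n := n) (quotGrading I)

end Quotient

end MonomialSplitting

end

/-!
The exact sequence `0 → R/(J ∩ K) → R/J × R/K → R/(J + K) → 0` bounds `pd R/(J + K)` by `q + 1`.
If the bound were strict, then `Tor_{q+1}(R/(J + K), 𝕜) = 0`, so the degree-preserving map
`Tor_q(R/(J ∩ K), 𝕜) → Tor_q(R/J, 𝕜) × Tor_q(R/K, 𝕜)` would be injective. In degree `q + r` its
target vanishes: the first factor because `pd R/J < q`, the second because `reg R/K < r`. This
contradicts `β_{q,q+r}(R/(J ∩ K)) ≠ 0`.
-/

namespace MonomialSplitting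

section Tor

variable {𝕜 : Type u} [Field 𝕜] {n : ℕ} {M N P : Type u}
  [AddCommGroup M] [Module (Poly 𝕜 n) M] [AddCommGroup N] [Module (Poly 𝕜 n) N]
  [AddCommGroup P] [Module (Poly 𝕜 n) P]

theorem torD_torD (p : ℕ) (x : TorChain (𝕜 := 𝕜) (n := n) M (p + 2)) :
    torD M p (torD M (p + 1) x) = 0 := by
  rw [torD, torD, ← LinearMap.lTensor_comp_apply,
    ((residueResolution 𝕜 n).exact_succ p).linearMap_comp_eq_zero, LinearMap.lTensor_zero,
    LinearMap.zero_apply]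

theorem torD_mem_torCycles {p : ℕ} (x : TorChain (𝕜 := 𝕜) (n := n) M (p + 1)) :
    torD M p x ∈ torCycles M p := by
  cases p with
  | zero => trivial
  | succ p => exact torD_torD p x

/-- The class in `Tor_p(M, 𝕜)` of a cycle of `M ⊗ F`. -/
noncomputable def torClass (p : ℕ) :
    torCycles (𝕜 := 𝕜) (n := n) M p →ₗ[Poly 𝕜 n] GradedTor (𝕜 := 𝕜) (n := n) M p :=
  Submodule.mkQ _

theorem torClass_surjective (p : ℕ) :
    Function.Surjective (torClass (𝕜 := 𝕜) (n := n) (M := M) p) :=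
  Submodule.mkQ_surjective _

theorem torClass_eq_zero_iff {p : ℕ} {z : torCycles (𝕜 := 𝕜) (n := n) M p} :
    torClass p z = 0 ↔ z.1 ∈ LinearMap.range (torD M p) :=
  Submodule.Quotient.mk_eq_zero _

theorem subsingleton_gradedTor_iff {p : ℕ} :
    Subsingleton (GradedTor (𝕜 := 𝕜) (n := n) M p) ↔
      torCycles (𝕜 := 𝕜) (n := n) M p ≤ LinearMap.range (torD M p) := by
  rw [Submodule.Quotient.subsingleton_iff, Submodule.submoduleOf_eq_top]

theorem subsingleton_gradedTor_succ_of_flat [Module.Flat (Poly 𝕜 n) M] (p : ℕ) :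
    Subsingleton (GradedTor (𝕜 := 𝕜) (n := n) M (p + 1)) :=
  subsingleton_gradedTor_iff.2 fun z hz =>
    (Module.Flat.lTensor_exact M ((residueResolution 𝕜 n).exact_succ p) z).1 hz

/-- The map `M ⊗ F_p → N ⊗ F_p` induced by a linear map `M → N`. -/
noncomputable abbrev torChainMap (f : M →ₗ[Poly 𝕜 n] N) (p : ℕ) :
    TorChain (𝕜 := 𝕜) (n := n) M p →ₗ[Poly 𝕜 n] TorChain (𝕜 := 𝕜) (n := n) N p :=
  LinearMap.rTensor _ f

theorem torChainMap_torD (f : M →ₗ[Poly 𝕜 n] N) (p : ℕ)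
    (x : TorChain (𝕜 := 𝕜) (n := n) M (p + 1)) :
    torChainMap f p (torD M p x) = torD N p (torChainMap f (p + 1) x) := by
  simp only [torChainMap, torD, ← LinearMap.comp_apply, LinearMap.rTensor_comp_lTensor,
    LinearMap.lTensor_comp_rTensor]

theorem torChainMap_mem_torCycles (f : M →ₗ[Poly 𝕜 n] N) {p : ℕ}
    {z : TorChain (𝕜 := 𝕜) (n := n) M p} (hz : z ∈ torCycles (𝕜 := 𝕜) (n := n) M p) :
    torChainMap f p z ∈ torCycles (𝕜 := 𝕜) (n := n) N p := by
  cases p with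
  | zero => trivial
  | succ p =>
    change torD N p _ = 0
    rw [← torChainMap_torD, show torD M p z = 0 from hz, map_zero]

theorem torChainMap_injective {f : M →ₗ[Poly 𝕜 n] N} (hf : Function.Injective f) (p : ℕ) :
    Function.Injective (torChainMap f p) :=
  Module.Flat.rTensor_preserves_injective_linearMap f hf

theorem mem_torCycles_of_torChainMap_mem {f : M →ₗ[Poly 𝕜 n] N} (hf : Function.Injective f)
    {p : ℕ} {z : TorChain (𝕜 := 𝕜) (n := n) M p}
    (hz : torChainMap f p z ∈ torCycles (𝕜 := 𝕜) (n := n) N p) :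
    z ∈ torCycles (𝕜 := 𝕜) (n := n) M p := by
  cases p with
  | zero => trivial
  | succ p =>
    refine torChainMap_injective hf p ?_
    rw [torChainMap_torD, map_zero]
    exact hz

/-- The map `Tor_p(M, 𝕜) → Tor_p(N, 𝕜)` induced by a linear map `M → N`. -/
noncomputable def torMap (f : M →ₗ[Poly 𝕜 n] N) (p : ℕ) :
    GradedTor (𝕜 := 𝕜) (n := n) M p →ₗ[Poly 𝕜 n] GradedTor (𝕜 := 𝕜) (n := n) N p :=
  Submodule.mapQ _ _ ((torChainMap f p).restrict fun _ => torChainMap_mem_torCycles f) <| by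
    rintro z ⟨x, hx⟩
    refine ⟨torChainMap f (p + 1) x, ?_⟩
    rw [← torChainMap_torD, hx]
    rfl

theorem torMap_torClass (f : M →ₗ[Poly 𝕜 n] N) {p : ℕ}
    (z : torCycles (𝕜 := 𝕜) (n := n) M p) :
    torMap f p (torClass p z) =
      torClass p ⟨torChainMap f p z, torChainMap_mem_torCycles f z.2⟩ :=
  rfl

theorem torMap_id (p : ℕ) : torMap (LinearMap.id : M →ₗ[Poly 𝕜 n] M) p = LinearMap.id := by
  refine LinearMap.ext fun x => ?_
  obtain ⟨z, rfl⟩ := torClass_surjective p x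
  simp only [torMap_torClass, torChainMap, LinearMap.rTensor_id, LinearMap.id_apply]

theorem torMap_comp_apply (g : N →ₗ[Poly 𝕜 n] P) (f : M →ₗ[Poly 𝕜 n] N) (p : ℕ)
    (x : GradedTor (𝕜 := 𝕜) (n := n) M p) :
    torMap (g ∘ₗ f) p x = torMap g p (torMap f p x) := by
  obtain ⟨z, rfl⟩ := torClass_surjective p x
  simp only [torMap_torClass, torChainMap, LinearMap.rTensor_comp_apply]

theorem torMap_add_apply (f g : M →ₗ[Poly 𝕜 n] N) (p : ℕ)
    (x : GradedTor (𝕜 := 𝕜) (n := n) M p) :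
    torMap (f + g) p x = torMap f p x + torMap g p x := by
  obtain ⟨z, rfl⟩ := torClass_surjective p x
  simp only [torMap_torClass, ← map_add, torChainMap, LinearMap.rTensor_add, LinearMap.add_apply]
  rfl

theorem eq_zero_of_torMap_fst_of_torMap_snd {p : ℕ}
    {x : GradedTor (𝕜 := 𝕜) (n := n) (M × N) p}
    (hfst : torMap (LinearMap.fst _ M N) p x = 0) (hsnd : torMap (LinearMap.snd _ M N) p x = 0) :
    x = 0 := by
  have hid : LinearMap.inl (Poly 𝕜 n) M N ∘ₗ LinearMap.fst _ M N +
      LinearMap.inr _ M N ∘ₗ LinearMap.snd _ M N = LinearMap.id := by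
    ext <;> simp
  calc
    x = torMap (LinearMap.inl (Poly 𝕜 n) M N ∘ₗ LinearMap.fst _ M N +
        LinearMap.inr _ M N ∘ₗ LinearMap.snd _ M N) p x := by
      rw [hid, torMap_id, LinearMap.id_apply]
    _ = 0 := by
      rw [torMap_add_apply, torMap_comp_apply, torMap_comp_apply, hfst, hsnd, map_zero, map_zero,
        add_zero]

section Exact

variable {f : M →ₗ[Poly 𝕜 n] N} {g : N →ₗ[Poly 𝕜 n] P}

theorem torChainMap_exact (hfg : Function.Exact f g) (hg : Function.Surjective g) (p : ℕ) :
    Function.Exact (torChainMap f p) (torChainMap g p) :=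
  rTensor_exact _ hfg hg

theorem torMap_injective_of_exact (hf : Function.Injective f) (hfg : Function.Exact f g)
    (hg : Function.Surjective g) {p : ℕ}
    (hP : Subsingleton (GradedTor (𝕜 := 𝕜) (n := n) P (p + 1))) :
    Function.Injective (torMap f p) := by
  rw [injective_iff_map_eq_zero]
  intro x hx
  obtain ⟨z, rfl⟩ := torClass_surjective p x
  obtain ⟨b, hb⟩ := torClass_eq_zero_iff.1 hx
  replace hb : torD N p b = torChainMap f p z := hb
  have hgb : torChainMap g (p + 1) b ∈ torCycles P (p + 1) := by
    change torD P p _ = 0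
    rw [← torChainMap_torD, hb, (torChainMap_exact hfg hg p).apply_apply_eq_zero]
  obtain ⟨c', hc'⟩ := subsingleton_gradedTor_iff.1 hP hgb
  obtain ⟨c, rfl⟩ := LinearMap.rTensor_surjective _ hg c'
  have hbc : torChainMap g (p + 1) (b - torD N (p + 1) c) = 0 := by
    rw [map_sub, torChainMap_torD, hc', sub_self]
  obtain ⟨a, ha⟩ := (torChainMap_exact hfg hg (p + 1) _).1 hbc
  refine torClass_eq_zero_iff.2 ⟨a, torChainMap_injective hf p ?_⟩
  rw [torChainMap_torD, ha, map_sub, torD_torD, sub_zero, hb]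

theorem subsingleton_gradedTor_succ_of_exact (hf : Function.Injective f)
    (hfg : Function.Exact f g) (hg : Function.Surjective g) {p : ℕ}
    (hM : Subsingleton (GradedTor (𝕜 := 𝕜) (n := n) M p))
    (hN : Subsingleton (GradedTor (𝕜 := 𝕜) (n := n) N (p + 1))) :
    Subsingleton (GradedTor (𝕜 := 𝕜) (n := n) P (p + 1)) := by
  refine subsingleton_gradedTor_iff.2 fun z hz => ?_
  obtain ⟨y, rfl⟩ := LinearMap.rTensor_surjective _ hg z
  have hdy : torChainMap g p (torD N p y) = 0 := (torChainMap_torD g p y).trans hz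
  obtain ⟨x, hx⟩ := (torChainMap_exact hfg hg p _).1 hdy
  have hx_cycle : x ∈ torCycles (𝕜 := 𝕜) (n := n) M p :=
    mem_torCycles_of_torChainMap_mem hf (hx ▸ torD_mem_torCycles y)
  obtain ⟨w, rfl⟩ := subsingleton_gradedTor_iff.1 hM hx_cycle
  have hyw : y - torChainMap f (p + 1) w ∈ torCycles (𝕜 := 𝕜) (n := n) N (p + 1) := by
    change torD N p _ = 0
    rw [map_sub, ← torChainMap_torD, hx, sub_self]
  obtain ⟨v, hv⟩ := subsingleton_gradedTor_iff.1 hN hyw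
  refine ⟨torChainMap g _ v, ?_⟩
  rw [← torChainMap_torD, hv, map_sub, (torChainMap_exact hfg hg _).apply_apply_eq_zero,
    sub_zero]

end Exact

open CategoryTheory in
theorem subsingleton_gradedTor_of_hasProjectiveDimensionLT {p : ℕ}
    (hM : HasProjectiveDimensionLT (ModuleCat.of (Poly 𝕜 n) M) p) :
    Subsingleton (GradedTor (𝕜 := 𝕜) (n := n) M p) := by
  induction p generalizing M with
  | zero =>
    have : Subsingleton M :=
      ModuleCat.subsingleton_of_isZero
        (isZero_of_hasProjectiveDimensionLT_zero (ModuleCat.of (Poly 𝕜 n) M))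
    infer_instance
  | succ p ih =>
    obtain _ | p := p
    · have : Module.Projective (Poly 𝕜 n) M :=
        (IsProjective.iff_projective M).2 (projective_iff_hasProjectiveDimensionLT_one.2 hM)
      exact subsingleton_gradedTor_succ_of_flat 0
    · let π := Finsupp.linearCombination (Poly 𝕜 n) (id : M → M)
      have hπ : Function.Surjective π := Finsupp.linearCombination_id_surjective _ _
      have hfree : Projective (ModuleCat.of (Poly 𝕜 n) (M →₀ Poly 𝕜 n)) :=
        (IsProjective.iff_projective _).1 inferInstance
      have hker : HasProjectiveDimensionLT (ModuleCat.of (Poly 𝕜 n) (LinearMap.ker π)) (p + 1) :=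
        ((LinearMap.shortExact_shortComplexKer hπ).hasProjectiveDimensionLT_X₃_iff p hfree).1 hM
      exact subsingleton_gradedTor_succ_of_exact (Submodule.subtype_injective _)
        (LinearMap.exact_subtype_ker_map π) hπ (ih hker) (subsingleton_gradedTor_succ_of_flat _)

end Tor

section Betti

variable {𝕜 : Type u} [Field 𝕜] {n : ℕ} {M N : Type u}
  [AddCommGroup M] [Module (Poly 𝕜 n) M] [Module 𝕜 M] [IsScalarTower 𝕜 (Poly 𝕜 n) M]
  [AddCommGroup N] [Module (Poly 𝕜 n) N] [Module 𝕜 N] [IsScalarTower 𝕜 (Poly 𝕜 n) N]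
  {𝓜 : ℕ → Submodule 𝕜 M} {𝓝 : ℕ → Submodule 𝕜 N}

theorem gradedBetti_eq_zero_iff {p j : ℕ} :
    gradedBetti (n := n) 𝓜 p j = 0 ↔ torGrading (n := n) 𝓜 p j = ⊥ := by
  rw [gradedBetti, Cardinal.toENat_eq_zero, rank_zero_iff, Submodule.subsingleton_iff_eq_bot]

theorem gradedBetti_eq_zero_of_hasProjectiveDimensionLT {p : ℕ}
    (hM : CategoryTheory.HasProjectiveDimensionLT (ModuleCat.of (Poly 𝕜 n) M) p) {j : ℕ} :
    gradedBetti (n := n) 𝓜 p j = 0 := by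
  have := subsingleton_gradedTor_of_hasProjectiveDimensionLT hM
  exact gradedBetti_eq_zero_iff.2 (Subsingleton.elim _ _)

theorem gradedBetti_eq_zero_of_regularity_lt {r : ℤ}
    (hr : regularity (n := n) 𝓜 < ((r : WithTop ℤ) : WithBot (WithTop ℤ))) {i j : ℕ}
    (hij : r ≤ j - i) : gradedBetti (n := n) 𝓜 i j = 0 := by
  by_contra hne
  have hle : ((((j : ℤ) - i : ℤ) : WithTop ℤ) : WithBot (WithTop ℤ)) ≤ regularity (n := n) 𝓜 :=
    le_sSup ⟨i, j, hne, rfl⟩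
  have hlt := hle.trans_lt hr
  rw [WithBot.coe_lt_coe, WithTop.coe_lt_coe] at hlt
  exact hij.not_gt hlt

theorem torChainMap_mem_torChainGrading {f : M →ₗ[Poly 𝕜 n] N}
    (hf : ∀ d, ∀ m ∈ 𝓜 d, f m ∈ 𝓝 d) {p j : ℕ} {z : TorChain (𝕜 := 𝕜) (n := n) M p}
    (hz : z ∈ torChainGrading 𝓜 p j) : torChainMap f p z ∈ torChainGrading 𝓝 p j := by
  suffices torChainGrading 𝓜 p j ≤
      (torChainGrading 𝓝 p j).comap ((torChainMap f p).restrictScalars 𝕜) from this hz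
  refine Submodule.span_le.2 ?_
  rintro _ ⟨d, m, a, hm, hd, rfl⟩
  exact Submodule.subset_span ⟨d, f m, a, hf d m hm, hd, rfl⟩

theorem torMap_mem_torGrading {f : M →ₗ[Poly 𝕜 n] N} (hf : ∀ d, ∀ m ∈ 𝓜 d, f m ∈ 𝓝 d) {p j : ℕ}
    {x : GradedTor (𝕜 := 𝕜) (n := n) M p} (hx : x ∈ torGrading 𝓜 p j) :
    torMap f p x ∈ torGrading 𝓝 p j := by
  obtain ⟨z, hz, rfl⟩ := hx
  exact ⟨⟨torChainMap f p z, torChainMap_mem_torCycles f z.2⟩,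
    torChainMap_mem_torChainGrading hf hz, rfl⟩

theorem gradedBetti_eq_zero_of_torMap_injective {f : M →ₗ[Poly 𝕜 n] N}
    (hf : ∀ d, ∀ m ∈ 𝓜 d, f m ∈ 𝓝 d) {p j : ℕ} (hinj : Function.Injective (torMap f p))
    (hN : gradedBetti (n := n) 𝓝 p j = 0) : gradedBetti (n := n) 𝓜 p j = 0 := by
  rw [gradedBetti_eq_zero_iff, Submodule.eq_bot_iff] at hN ⊢
  exact fun x hx => (map_eq_zero_iff _ hinj).1 (hN _ (torMap_mem_torGrading hf hx))

theorem gradedBetti_prod_eq_zero {p j : ℕ} (hM : gradedBetti (n := n) 𝓜 p j = 0)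
    (hN : gradedBetti (n := n) 𝓝 p j = 0) :
    gradedBetti (n := n) (fun d => (𝓜 d).prod (𝓝 d)) p j = 0 := by
  rw [gradedBetti_eq_zero_iff, Submodule.eq_bot_iff] at hM hN ⊢
  exact fun x hx => eq_zero_of_torMap_fst_of_torMap_snd
    (hM _ (torMap_mem_torGrading (fun _ _ hm => (Submodule.mem_prod.1 hm).1) hx))
    (hN _ (torMap_mem_torGrading (fun _ _ hm => (Submodule.mem_prod.1 hm).2) hx))

end Betti

section MayerVietoris

variable {A M : Type*} [Ring A] [AddCommGroup M] [Module A M] (U V : Submodule A M)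

/-- The diagonal map `M/(U ∩ V) → M/U × M/V` of the Mayer–Vietoris sequence. -/
def quotInfToProd : (M ⧸ U ⊓ V) →ₗ[A] (M ⧸ U) × (M ⧸ V) :=
  (Submodule.factor inf_le_left).prod (Submodule.factor inf_le_right)

/-- The difference map `M/U × M/V → M/(U + V)` of the Mayer–Vietoris sequence. -/
def prodToQuotSup : ((M ⧸ U) × (M ⧸ V)) →ₗ[A] M ⧸ U ⊔ V :=
  (Submodule.factor le_sup_left).coprod (-Submodule.factor le_sup_right)

theorem quotInfToProd_injective : Function.Injective (quotInfToProd U V) := by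
  rw [injective_iff_map_eq_zero]
  intro x hx
  obtain ⟨m, rfl⟩ := Submodule.mkQ_surjective _ x
  obtain ⟨hU, hV⟩ := Prod.ext_iff.1 hx
  exact (Submodule.Quotient.mk_eq_zero _).2
    ⟨(Submodule.Quotient.mk_eq_zero _).1 hU, (Submodule.Quotient.mk_eq_zero _).1 hV⟩

theorem prodToQuotSup_surjective : Function.Surjective (prodToQuotSup U V) := fun y => by
  obtain ⟨x, rfl⟩ := Submodule.factor_surjective (le_sup_left : U ≤ U ⊔ V) y
  exact ⟨(x, 0), by simp [prodToQuotSup]⟩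

theorem exact_quotInfToProd_prodToQuotSup :
    Function.Exact (quotInfToProd U V) (prodToQuotSup U V) := by
  refine LinearMap.exact_of_comp_of_mem_range ?_ ?_
  · ext m
    simp [quotInfToProd, prodToQuotSup]
  · rintro ⟨x, y⟩ hxy
    obtain ⟨a, rfl⟩ := Submodule.mkQ_surjective _ x
    obtain ⟨b, rfl⟩ := Submodule.mkQ_surjective _ y
    have hsub : a - b ∈ U ⊔ V := by
      rw [← Submodule.Quotient.mk_eq_zero, Submodule.Quotient.mk_sub, sub_eq_add_neg]
      exact hxy
    obtain ⟨u, hu, v, hv, huv⟩ := Submodule.mem_sup.1 hsub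
    refine ⟨Submodule.mkQ _ (a - u), Prod.ext ((Submodule.Quotient.eq U).2 ?_)
      ((Submodule.Quotient.eq V).2 ?_)⟩
    · simpa using hu
    · rwa [LinearMap.id_apply, sub_right_comm, ← huv, add_sub_cancel_left]

end MayerVietoris

section ProjectiveDimension

open CategoryTheory

theorem hasProjectiveDimensionLT_prod {A : Type*} [Ring A] {M N : Type u} [AddCommGroup M]
    [Module A M] [AddCommGroup N] [Module A N] {d : ℕ}
    [HasProjectiveDimensionLT (ModuleCat.of A M) d]
    [HasProjectiveDimensionLT (ModuleCat.of A N) d] :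
    HasProjectiveDimensionLT (ModuleCat.of A (M × N)) d :=
  hasProjectiveDimensionLT_of_iso (ModuleCat.biprodIsoProd (.of A M) (.of A N)) d

theorem hasProjectiveDimensionLT_quot_sup {A : Type*} [Ring A] {M : Type u} [AddCommGroup M]
    [Module A M] {U V : Submodule A M} {d : ℕ}
    [HasProjectiveDimensionLT (ModuleCat.of A (M ⧸ U ⊓ V)) d]
    [HasProjectiveDimensionLT (ModuleCat.of A (M ⧸ U)) (d + 1)]
    [HasProjectiveDimensionLT (ModuleCat.of A (M ⧸ V)) (d + 1)] :
    HasProjectiveDimensionLT (ModuleCat.of A (M ⧸ U ⊔ V)) (d + 1) :=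
  (ModuleCat.shortComplex_shortExact
    (ModuleCat.shortComplexOfCompEqZero (quotInfToProd U V) (prodToQuotSup U V)
      (exact_quotInfToProd_prodToQuotSup U V).linearMap_comp_eq_zero)
    (exact_quotInfToProd_prodToQuotSup U V) (quotInfToProd_injective U V)
    (prodToQuotSup_surjective U V)).hasProjectiveDimensionLT_X₃ d inferInstance
      hasProjectiveDimensionLT_prod

end ProjectiveDimension

section Splitting

variable {𝕜 : Type u} [Field 𝕜] {n : ℕ} {J K : Ideal (Poly 𝕜 n)} {q j : ℕ}

theorem pdQuot_sup_le (hJ : pdQuot J ≤ (q + 1 : ℕ)) (hK : pdQuot K ≤ (q + 1 : ℕ))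
    (hJK : pdQuot (J ⊓ K) ≤ q) : pdQuot (J ⊔ K) ≤ (q + 1 : ℕ) := by
  simp only [pdQuot, CategoryTheory.projectiveDimension_le_iff] at hJ hK hJK ⊢
  exact hasProjectiveDimensionLT_quot_sup

theorem quotInfToProd_mem_quotGrading {d : ℕ} {x : Poly 𝕜 n ⧸ J ⊓ K}
    (hx : x ∈ quotGrading (J ⊓ K) d) :
    quotInfToProd J K x ∈ (quotGrading J d).prod (quotGrading K d) := by
  obtain ⟨f, hf, rfl⟩ := hx
  exact ⟨⟨f, hf, rfl⟩, ⟨f, hf, rfl⟩⟩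

theorem le_pdQuot_sup (hJ : bettiQuot J q j = 0) (hK : bettiQuot K q j = 0)
    (hJK : bettiQuot (J ⊓ K) q j ≠ 0) : (q + 1 : ℕ) ≤ pdQuot (J ⊔ K) := by
  refine (CategoryTheory.projectiveDimension_ge_iff _ _).2 fun hlt => hJK ?_
  have hinj : Function.Injective (torMap (quotInfToProd J K) q) :=
    torMap_injective_of_exact (quotInfToProd_injective J K)
      (exact_quotInfToProd_prodToQuotSup J K) (prodToQuotSup_surjective J K)
      (subsingleton_gradedTor_of_hasProjectiveDimensionLT hlt)
  exact gradedBetti_eq_zero_of_torMap_injective (fun _ _ => quotInfToProd_mem_quotGrading) hinj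
    (gradedBetti_prod_eq_zero hJ hK)

theorem bettiQuot_eq_zero_of_pdQuot_lt (hJ : pdQuot J < q) : bettiQuot J q j = 0 :=
  gradedBetti_eq_zero_of_hasProjectiveDimensionLT
    (CategoryTheory.projectiveDimension_lt_iff.1 hJ)

end Splitting

end MonomialSplitting

open MonomialSplitting in
theorem mainTheorem6_general {𝕜 : Type u} [Field 𝕜] {n : ℕ} {J K : Ideal (Poly 𝕜 n)} {q j : ℕ}
    (hpdJ : pdQuot J ≤ (q + 1 : ℕ)) (hpdK : pdQuot K ≤ (q + 1 : ℕ)) (hpdJK : pdQuot (J ⊓ K) ≤ q)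
    (hJ : bettiQuot J q j = 0) (hK : bettiQuot K q j = 0) (hJK : bettiQuot (J ⊓ K) q j ≠ 0) :
    pdQuot (J ⊔ K) = (q + 1 : ℕ) :=
  le_antisymm (pdQuot_sup_le hpdJ hpdK hpdJK) (le_pdQuot_sup hJ hK hJK)

theorem mainTheorem6 {𝕜 : Type u} [Field 𝕜] {n : ℕ}
    (I J K : Ideal (MonomialSplitting.Poly 𝕜 n))
    (hI : MonomialSplitting.IsMonomialIdeal I)
    (hJ : MonomialSplitting.IsMonomialIdeal J)
    (hK : MonomialSplitting.IsMonomialIdeal K)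
    (hIJK : I = J + K) (q r : ℕ)
    (hpdJ : MonomialSplitting.pdQuot J < (q : WithBot ℕ∞))
    (hpdK : MonomialSplitting.pdQuot K = (q : WithBot ℕ∞))
    (hreg : MonomialSplitting.regQuot K < (((r : ℤ) : WithTop ℤ) : WithBot (WithTop ℤ)))
    (hpdJK : MonomialSplitting.pdQuot (J ⊓ K) = (q : WithBot ℕ∞))
    (hbetti : MonomialSplitting.bettiQuot (J ⊓ K) q (q + r) ≠ 0) :
    MonomialSplitting.pdQuot I = ((q + 1 : ℕ) : WithBot ℕ∞) := by
  have hq : (q : WithBot ℕ∞) ≤ (q + 1 : ℕ) := by exact_mod_cast q.le_succ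
  exact hIJK ▸ mainTheorem6_general (hpdJ.le.trans hq) (hpdK.trans_le hq) hpdJK.le
    (MonomialSplitting.bettiQuot_eq_zero_of_pdQuot_lt hpdJ)
    (MonomialSplitting.gradedBetti_eq_zero_of_regularity_lt hreg (by push_cast; lia)) hbetti
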